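/- All digraphs are finite, without loops and without parallel arcs, but may contain digons, where a digon is a pair of opposite arcs $xy, yx$ between the same two vertices. For a digraph $D$, let $\Delta_{\min}(D)=\max_{v\in V(D)}\min\{d^+(v),d^-(v)\}$, where $d^+(v)$ and $d^-(v)$ are the out-degree and the in-degree of $v$ (and $\Delta_{\min}(D)=0$ if $D$ has no vertices). The digraph $D$ is $k$-dicolourable if there is a map $c:V(D)\to\{1,\dots,k\}$ such that, for each $i\in\{1,\dots,k\}$, the subdigraph of $D$ induced by $c^{-1}(i)$ has no directed cycle (a digon being a directed cycle of length $2$). Let $\overleftrightarrow{K_n}$ be the complete bidirected graph on $n$ vertices, in which every two distinct vertices are joined by a digon, and let $H_1\Rightarrow H_2$ be the directed join, obtained from disjoint copies of $H_1$ and $H_2$ by adding all arcs from the copy of $H_1$ to the copy of $H_2$ ($H_1$ or $H_2$ may be empty). A digraph contains $H$ if it has a (not necessarily induced) subdigraph isomorphic to $H$. **Theorem.** Let $D$ be a digraph. If $D$ is not $\Delta_{\min}(D)$-dicolourable, then one of the following holds: - $\Delta_{\min}(D)\le 1$; or - $\Delta_{\min}(D)=2$ and $D$ contains $\overleftrightarrow{K_2}$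 (that is, a digon); or - $\Delta_{\min}(D)\ge 3$ and $D$ contains $\overleftrightarrow{K_r}\Rightarrow\overleftrightarrow{K_s}$ for some integers $r,s\ge 0$ with $r+s=\Delta_{\min}(D)+1$. -/

import Mathlib

namespace Digraph

/-- The out-degree of `v`: the number of arcs leaving `v`. -/
noncomputable def outDegree {V : Type*} (D : Digraph V) (v : V) : ℕ :=
  {w : V | D.Adj v w}.ncard

/-- The in-degree of `v`: the number of arcs entering `v`. -/
noncomputable def inDegree {V : Type*} (D : Digraph V) (v : V) : ℕ :=
  {u : V | D.Adj u v}.ncard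

/-- The minimum degree of the vertex `v`: the smaller of its out-degree and in-degree. -/
noncomputable def dMin {V : Type*} (D : Digraph V) (v : V) : ℕ :=
  min (D.outDegree v) (D.inDegree v)

/-- `Δ_min(D)`: the maximum over all vertices of the minimum degree of the vertex
(`0` for the digraph without vertices). -/
noncomputable def deltaMin {V : Type*} [Fintype V] (D : Digraph V) : ℕ :=
  Finset.univ.sup D.dMin

/-- The subdigraph of `D` induced by a set `s` of vertices. -/
def induce {V : Type*} (D : Digraph V) (s : Set V) : Digraph s where
  Adj a b := D.Adj a b

/-- A digraph is acyclic if it has no directed cycle, that is, if no vertex can be reached from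
itself along a directed walk with at least one arc. -/
def IsAcyclic {V : Type*} (D : Digraph V) : Prop :=
  ∀ v : V, ¬ Relation.TransGen D.Adj v v

/-- A `k`-dicolouring: every colour class induces an acyclic subdigraph. -/
def IsDicolouring {V : Type*} (D : Digraph V) {k : ℕ} (c : V → Fin k) : Prop :=
  ∀ i : Fin k, (D.induce (c ⁻¹' {i})).IsAcyclic

/-- A digraph is `k`-dicolourable if it admits a `k`-dicolouring. -/
def Dicolourable {V : Type*} (D : Digraph V) (k : ℕ) : Prop :=
  ∃ c : V → Fin k, D.IsDicolouring c

/-- `D` contains (a copy of) `H` as a subdigraph, not necessarily induced. -/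
def Contains {V W : Type*} (D : Digraph V) (H : Digraph W) : Prop :=
  ∃ f : W ↪ V, ∀ a b : W, H.Adj a b → D.Adj (f a) (f b)

/-- The bidirected graph associated to `G`: every edge is replaced by a digon. -/
def bidirected {V : Type*} (G : SimpleGraph V) : Digraph V where
  Adj := G.Adj

/-- The bidirected complete graph on `n` vertices. -/
def bidirectedComplete (n : ℕ) : Digraph (Fin n) :=
  bidirected (⊤ : SimpleGraph (Fin n))

/-- The directed join `H₁ ⇒ H₂`: disjoint copies of `H₁` and `H₂` together with all arcs from the
copy of `H₁` to the copy of `H₂`. -/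
def directedJoin {V W : Type*} (H₁ : Digraph V) (H₂ : Digraph W) : Digraph (V ⊕ W) where
  Adj
    | Sum.inl a, Sum.inl b => H₁.Adj a b
    | Sum.inr a, Sum.inr b => H₂.Adj a b
    | Sum.inl _, Sum.inr _ => True
    | Sum.inr _, Sum.inl _ => False

end Digraph

/-!
Let `k = Δ_min(D)` and let `X` be the set of vertices of out-degree at most `k`, so that the other
vertices have in-degree at most `k`. Let `D'` be obtained from `D` by replacing every arc from `X`
to its complement by a digon and deleting the remaining arcs from the complement to `X`
(`symmetrize`). A dicolouring of `D'` is one of `D`, since a cycle of `D` that leaves `X` uses an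
arc that became a digon. So `D'` is not `k`-dicolourable and has a critical induced subdigraph `H`
(`exists_isCritical`). In `H` all degrees are at least `k`; out-degrees on `X` and in-degrees off
`X` are at most `k`, and as the arcs across are symmetric, counting arcs makes all degrees equal
to `k` (`ncard_in_le_of_symm`).

The rest is a directed version of Brooks' theorem for `H`. If `v` has two out-neighbours `a`, `b`
that do not form a digon, then greedy colouring towards `v`, with `a` and `b` of the same colour,
can only fail because `{a, b}` separates `H` (`IsCritical.exists_cutPair`). For a cut pair
`{x, y}`, one of the two sides forces `x` and `y` to share a colour
(`IsCritical.forced_or_forced`); then `x` and `y` each have at least `k - 1` out-neighbours on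
this side, hence at most one on the other side, where a colour avoiding these at most two
vertices lets the colourings be combined. This excludes cut pairs when `k ≥ 3`
(`IsCritical.not_cutPair`). Hence all out-neighbourhoods are bidirected cliques, which yields a
bidirected clique on `k + 1` vertices (`IsCritical.exists_clique`); splitting it along `X` gives
the directed join in `D`.

When `k = 2`, the same analysis shows that the out-neighbours of `v` form a digon unless the out-
and in-neighbourhoods of `v` agree (`IsCritical.arc_of_two`). If the digons of `H` were exactly
the arcs between `X` and its complement, some `v` would have distinct out- and in-neighbourhoods,
each of them a digon across, and the degree bound gives a contradiction
(`IsCritical.exists_digon_same_side`). A digon of `H` on one side of `X` is a digon of `D`.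
-/

open Relation

namespace DirectedBrooks

/-! ### Acyclic relations and colourings without monochromatic cycles -/

/-- The colouring `c` has no monochromatic directed cycle inside the vertex set `S`. -/
def MonoAcyclic {V α : Type*} (r : V → V → Prop) (S : Set V) (c : V → α) : Prop :=
  ∀ v, ¬ TransGen (fun a b => r a b ∧ a ∈ S ∧ b ∈ S ∧ c a = c b) v v

/-- A relation is acyclic if no arc leaves `P` and it is acyclic inside and outside `P`. -/
theorem acyclic_of_closed {V : Type*} {r : V → V → Prop} (P : Set V)
    (hP : ∀ a b, r a b → a ∈ P → b ∈ P)
    (h1 : ∀ v, ¬ TransGen (fun a b => r a b ∧ a ∈ P ∧ b ∈ P) v v)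
    (h2 : ∀ v, ¬ TransGen (fun a b => r a b ∧ a ∉ P ∧ b ∉ P) v v) (v : V) :
    ¬ TransGen r v v := by
  intro h
  by_cases hv : v ∈ P
  · have key : ∀ w, TransGen r v w → w ∈ P ∧ TransGen (fun a b => r a b ∧ a ∈ P ∧ b ∈ P) v w := by
      intro w hw
      induction hw with
      | single h => exact ⟨hP _ _ h hv, .single ⟨h, hv, hP _ _ h hv⟩⟩
      | tail _ h ih => exact ⟨hP _ _ h ih.1, ih.2.tail ⟨h, ih.1, hP _ _ h ih.1⟩⟩
    exact h1 v (key v h).2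
  · have key : ∀ w, TransGen r v w → w ∉ P →
        TransGen (fun a b => r a b ∧ a ∉ P ∧ b ∉ P) v w := by
      intro w hw
      induction hw with
      | single h => exact fun hw => .single ⟨h, hv, hw⟩
      | tail _ h ih =>
        intro hw
        have hb := fun hb => hw (hP _ _ h hb)
        exact (ih hb).tail ⟨h, hb, hw⟩
    exact h2 v (key v h hv)

/-- A relation covered by two vertex sets `A` and `B` is acyclic if it is acyclic inside each of
them and no vertex of `A ∩ B` reaches another one. -/
theorem acyclic_of_separated {V : Type*} {r : V → V → Prop} (A B : Set V)
    (hcov : ∀ a b, r a b → (a ∈ A ∧ b ∈ A) ∨ (a ∈ B ∧ b ∈ B))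
    (hsep : ∀ a b, a ∈ A → a ∈ B → b ∈ A → b ∈ B → ReflTransGen r a b → a = b)
    (h1 : ∀ v, ¬ TransGen (fun a b => r a b ∧ a ∈ A ∧ b ∈ A) v v)
    (h2 : ∀ v, ¬ TransGen (fun a b => r a b ∧ a ∈ B ∧ b ∈ B) v v) (v : V) :
    ¬ TransGen r v v := by
  intro h
  wlog hv : v ∈ A generalizing A B
  · refine this B A (fun a b hab => (hcov a b hab).symm)
      (fun a b h1 h2 h3 h4 => hsep a b h2 h1 h4 h3) h2 h1 ?_
    obtain ⟨w, hw, -⟩ := TransGen.head'_iff.1 h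
    exact ((hcov _ _ hw).resolve_left fun h => hv h.1).1
  have key : ∀ w, TransGen r v w →
      (w ∈ A ∧ TransGen (fun a b => r a b ∧ a ∈ A ∧ b ∈ A) v w) ∨
      (∃ x, x ∈ A ∧ x ∈ B ∧ w ∈ B ∧ ReflTransGen r v x ∧
        TransGen (fun a b => r a b ∧ a ∈ B ∧ b ∈ B) x w) := by
    intro w hw
    induction hw with
    | single h =>
      rcases hcov _ _ h with h' | h'
      · exact .inl ⟨h'.2, .single ⟨h, h'⟩⟩
      · exact .inr ⟨v, hv, h'.1, h'.2, .refl, .single ⟨h, h'⟩⟩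
    | tail h0 h ih =>
      rcases hcov _ _ h with h' | h' <;> rcases ih with ih | ⟨x, hxA, hxB, hwB, hx, ih⟩
      · exact .inl ⟨h'.2, ih.2.tail ⟨h, h'⟩⟩
      · have e := hsep _ _ hxA hxB h'.1 hwB
          (TransGen.to_reflTransGen (ih.lift id fun _ _ h => h.1))
        subst e
        exact (h2 _ ih).elim
      · exact .inr ⟨_, ih.1, h'.1, h'.2, h0.to_reflTransGen, .single ⟨h, h'⟩⟩
      · exact .inr ⟨x, hxA, hxB, h'.2, hx, ih.tail ⟨h, h'⟩⟩
  rcases key v h with h | ⟨x, hxA, hxB, hvB, hx, h⟩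
  · exact h1 v h.2
  · have e := hsep _ _ hv hvB hxA hxB hx
    subst e
    exact h2 _ h

section MonoAcyclic

variable {V α : Type*} {r : V → V → Prop} {S T : Set V} {c : V → α}

theorem MonoAcyclic.mono (h : MonoAcyclic r T c) (hST : S ⊆ T) : MonoAcyclic r S c :=
  fun v hv => h v (hv.lift id fun _ _ h => ⟨h.1, hST h.2.1, hST h.2.2.1, h.2.2.2⟩)

theorem MonoAcyclic.congr {c' : V → α} (h : MonoAcyclic r S c) (hc : ∀ v ∈ S, c' v = c v) :
    MonoAcyclic r S c' :=
  fun v hv => h v (hv.lift id fun a b h => ⟨h.1, h.2.1, h.2.2.1,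
    (hc a h.2.1).symm.trans (h.2.2.2.trans (hc b h.2.2.1))⟩)

theorem MonoAcyclic.comp {β : Type*} (h : MonoAcyclic r S c) {σ : α → β}
    (hσ : Function.Injective σ) : MonoAcyclic r S (σ ∘ c) :=
  fun v hv => h v (hv.lift id fun _ _ h => ⟨h.1, h.2.1, h.2.2.1, hσ h.2.2.2⟩)

theorem MonoAcyclic.swap (h : MonoAcyclic r S c) : MonoAcyclic (Function.swap r) S c := by
  intro v hv
  rw [← transGen_swap] at hv
  exact h v (hv.lift id fun _ _ h => ⟨h.1, h.2.2.1, h.2.1, h.2.2.2.symm⟩)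

theorem MonoAcyclic.union (hS : MonoAcyclic r S c) (hT : MonoAcyclic r T c)
    (hST : ∀ a ∈ S, ∀ b ∈ T, r a b → c a = c b → b ∈ S) : MonoAcyclic r (S ∪ T) c := by
  refine acyclic_of_closed S ?_ ?_ ?_
  · rintro a b ⟨h, -, hb | hb, hc⟩ ha
    · exact hb
    · exact hST a ha b hb h hc
  · exact fun v hv => hS v (hv.lift id fun _ _ h => ⟨h.1.1, h.2.1, h.2.2, h.1.2.2.2⟩)
  · exact fun v hv => hT v (hv.lift id fun _ _ h =>
      ⟨h.1.1, h.1.2.1.resolve_left h.2.1, h.1.2.2.1.resolve_left h.2.2, h.1.2.2.2⟩)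

theorem MonoAcyclic.singleton {v : V} (hv : ¬ r v v) : MonoAcyclic r {v} c := by
  intro w hw
  obtain ⟨b, ⟨h, ha, hb, -⟩, -⟩ := TransGen.head'_iff.1 hw
  rw [Set.mem_singleton_iff] at ha hb
  subst ha hb
  exact hv h

/-- A vertex may receive any colour that is absent from its out-neighbourhood. -/
theorem MonoAcyclic.insert_of_out [DecidableEq V] (hS : MonoAcyclic r S c) {v : V} (hv : v ∉ S)
    (hr : ¬ r v v) {j : α} (hj : ∀ u ∈ S, r v u → c u ≠ j) :
    MonoAcyclic r (insert v S) (Function.update c v j) := by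
  have h1 : MonoAcyclic r S (Function.update c v j) :=
    hS.congr fun u hu => Function.update_of_ne (ne_of_mem_of_not_mem hu hv) _ _
  rw [Set.insert_eq]
  refine (MonoAcyclic.singleton hr).union h1 ?_
  rintro a rfl b hb hab hc
  rw [Function.update_self, Function.update_of_ne (ne_of_mem_of_not_mem hb hv)] at hc
  exact (hj b hb hab hc.symm).elim

/-- A vertex may receive any colour that is absent from its in-neighbourhood. -/
theorem MonoAcyclic.insert_of_in [DecidableEq V] (hS : MonoAcyclic r S c) {v : V} (hv : v ∉ S)
    (hr : ¬ r v v) {j : α} (hj : ∀ u ∈ S, r u v → c u ≠ j) :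
    MonoAcyclic r (insert v S) (Function.update c v j) :=
  (hS.swap.insert_of_out (r := Function.swap r) hv hr hj).swap

end MonoAcyclic

/-! ### Critical digraphs -/

/-- Some colour is missing on a set with fewer elements than there are colours. -/
theorem exists_colour_notMem {V : Type*} [Finite V] {k : ℕ} (N : Set V) (hN : N.ncard < k)
    (c : V → Fin k) : ∃ j, ∀ u ∈ N, c u ≠ j := by
  by_contra! h
  have h1 : (c '' N) = Set.univ := by
    ext j
    simpa using h j
  have h2 := Set.ncard_image_le (f := c) N.toFinite
  rw [h1, Set.ncard_univ, Nat.card_fin] at h2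
  omega

/-- The loopless relation `r` is not `k`-dicolourable, but its restriction to every proper set of
vertices is. -/
structure IsCritical {V : Type*} (r : V → V → Prop) (k : ℕ) : Prop where
  irrefl : ∀ v, ¬ r v v
  not_colourable : ∀ c : V → Fin k, ¬ MonoAcyclic r Set.univ c
  colourable : ∀ S : Set V, S ≠ Set.univ → ∃ c : V → Fin k, MonoAcyclic r S c

section Critical

variable {V : Type*} {r : V → V → Prop} {k : ℕ}

theorem IsCritical.swap (h : IsCritical r k) : IsCritical (Function.swap r) k where
  irrefl := h.irrefl
  not_colourable c hc := h.not_colourable c hc.swap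
  colourable S hS := (h.colourable S hS).imp fun _ hc => hc.swap

theorem IsCritical.exists_out (h : IsCritical r k) {v : V} {c : V → Fin k}
    (hc : MonoAcyclic r {v}ᶜ c) (j : Fin k) : ∃ u, r v u ∧ c u = j := by
  classical
  by_contra! hj
  refine h.not_colourable _ ((hc.insert_of_out (j := j) (by simp) (h.irrefl v)
    fun u _ hu => hj u hu).mono ?_)
  intro x _
  by_cases hx : x = v <;> simp [hx]

theorem IsCritical.le_out [Finite V] (h : IsCritical r k) (v : V) : k ≤ {w | r v w}.ncard := by
  obtain ⟨c, hc⟩ := h.colourable {v}ᶜ (by simp)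
  by_contra! hlt
  obtain ⟨j, hj⟩ := exists_colour_notMem _ hlt c
  obtain ⟨u, hu, hcu⟩ := h.exists_out hc j
  exact hj u hu hcu

/-! ### Cut pairs of critical digraphs -/

/-- `{x, y}` separates the nonempty set `S` from the nonempty set `T`. -/
structure IsCutPair {V : Type*} (r : V → V → Prop) (x y : V) (S T : Set V) : Prop where
  ne : x ≠ y
  left_notMem_left : x ∉ S
  left_notMem_right : x ∉ T
  right_notMem_left : y ∉ S
  right_notMem_right : y ∉ T
  disjoint : ∀ v ∈ S, v ∉ T
  cover : ∀ v, v = x ∨ v = y ∨ v ∈ S ∨ v ∈ T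
  nonempty_left : S.Nonempty
  nonempty_right : T.Nonempty
  no_arc : ∀ a ∈ S, ∀ b ∈ T, ¬ r a b ∧ ¬ r b a

theorem IsCutPair.symm {x y : V} {S T : Set V} (h : IsCutPair r x y S T) :
    IsCutPair r x y T S :=
  ⟨h.ne, h.3, h.2, h.5, h.4, fun v hT hS => h.disjoint v hS hT,
    fun v => by have := h.cover v; tauto, h.9, h.8, fun a ha b hb => (h.no_arc b hb a ha).symm⟩

theorem IsCutPair.comm {x y : V} {S T : Set V} (h : IsCutPair r x y S T) :
    IsCutPair r y x S T :=
  ⟨h.ne.symm, h.4, h.5, h.2, h.3, h.disjoint,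
    fun v => by have := h.cover v; tauto, h.8, h.9, h.no_arc⟩

theorem IsCutPair.swap {x y : V} {S T : Set V} (h : IsCutPair r x y S T) :
    IsCutPair (Function.swap r) x y S T :=
  ⟨h.1, h.2, h.3, h.4, h.5, h.6, h.7, h.8, h.9, fun a ha b hb => (h.no_arc a ha b hb).symm⟩

/-- Two out-neighbours `a`, `b` of `v` that do not form a digon may share a colour. Were their
deletion to leave the digraph connected, colouring the other vertices greedily towards `v` would
give a colouring of everything, as `v` sees a repeated colour. -/
theorem IsCritical.exists_cutPair [Finite V] (h : IsCritical r k)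
    (hout : ∀ v, {w | r v w}.ncard ≤ k) (hin : ∀ v, {w | r w v}.ncard ≤ k)
    {v a b : V} (ha : r v a) (hb : r v b) (hab : a ≠ b) (hnd : ¬ r a b) :
    ∃ S T, v ∈ S ∧ IsCutPair r a b S T := by
  classical
  have hva : a ≠ v := fun e => h.irrefl v (e ▸ ha)
  have hvb : b ≠ v := fun e => h.irrefl v (e ▸ hb)
  -- `R` is a set of uncoloured vertices which can always be coloured greedily.
  let good : Set V → Prop := fun R => v ∈ R ∧ a ∉ R ∧ b ∉ R ∧
    ∀ c : V → Fin k, MonoAcyclic r Rᶜ c → c a ≠ c b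
  have hgood : good {v} := by
    refine ⟨rfl, hva, hvb, fun c hc e => ?_⟩
    have hlt : ({w | r v w} \ {a}).ncard < k := by
      have := Set.ncard_sdiff_singleton_lt_of_mem (s := {w | r v w}) ha
      exact this.trans_le (hout v)
    obtain ⟨j, hj⟩ := exists_colour_notMem _ hlt c
    obtain ⟨u, hu, hcu⟩ := h.exists_out hc j
    by_cases hua : u = a
    · subst hua
      exact hj b ⟨hb, hab.symm⟩ (e ▸ hcu)
    · exact hj u ⟨hu, hua⟩ hcu
  obtain ⟨R, hR, hmax⟩ := Set.Finite.exists_maximal (Set.toFinite {R | good R}) ⟨_, hgood⟩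
  obtain ⟨hvR, haR, hbR, hcR⟩ := hR
  have hstep : ∀ w, w ∉ R → w ≠ a → w ≠ b → ∀ z ∈ R, ¬ r w z ∧ ¬ r z w := by
    intro w hwR hwa hwb z hz
    have hw : ∀ c : V → Fin k, ∀ j, MonoAcyclic r (insert w R)ᶜ c → c a = c b →
        ((∀ u ∈ (insert w R)ᶜ, r w u → c u ≠ j) ∨ (∀ u ∈ (insert w R)ᶜ, r u w → c u ≠ j)) →
        False := by
      intro c j hc e hj
      have key : MonoAcyclic r (insert w (insert w R)ᶜ) (Function.update c w j) := by
        rcases hj with hj | hj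
        · exact hc.insert_of_out (by simp) (h.irrefl w) hj
        · exact hc.insert_of_in (by simp) (h.irrefl w) hj
      refine hcR _ (key.mono ?_) ?_
      · intro u hu
        by_cases huw : u = w
        · exact .inl huw
        · exact .inr fun h => h.elim huw hu
      · rw [Function.update_of_ne hwa.symm, Function.update_of_ne hwb.symm, e]
    by_contra hcon
    have hgw : good (insert w R) := by
      refine ⟨.inr hvR, fun h => h.elim hwa.symm haR, fun h => h.elim hwb.symm hbR,
        fun c hc e => ?_⟩
      by_cases hwz : r w z
      · have hlt : ({u | r w u} \ {z}).ncard < k :=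
          (Set.ncard_sdiff_singleton_lt_of_mem (s := {u | r w u}) hwz).trans_le (hout w)
        obtain ⟨j, hj⟩ := exists_colour_notMem _ hlt c
        refine hw c j hc e (.inl fun u hu hwu => hj u ⟨hwu, ?_⟩)
        rintro rfl
        exact hu (.inr hz)
      · have hzw : r z w := by tauto
        have hlt : ({u | r u w} \ {z}).ncard < k :=
          (Set.ncard_sdiff_singleton_lt_of_mem (s := {u | r u w}) hzw).trans_le (hin w)
        obtain ⟨j, hj⟩ := exists_colour_notMem _ hlt c
        refine hw c j hc e (.inr fun u hu hwu => hj u ⟨hwu, ?_⟩)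
        rintro rfl
        exact hu (.inr hz)
    exact hwR (hmax hgw (Set.subset_insert w R) (Set.mem_insert w R))
  refine ⟨R, {w | w ∉ R ∧ w ≠ a ∧ w ≠ b}, hvR, hab, haR, fun h => h.2.1 rfl, hbR,
    fun h => h.2.2 rfl, fun v hv h => h.1 hv, fun w => ?_, ⟨v, hvR⟩, ?_, ?_⟩
  · by_cases h1 : w = a
    · exact .inl h1
    by_cases h2 : w = b
    · exact .inr (.inl h2)
    by_cases h3 : w ∈ R
    · exact .inr (.inr (.inl h3))
    · exact .inr (.inr (.inr ⟨h3, h1, h2⟩))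
  · -- Otherwise only `a` and `b` are coloured, and they may share a colour.
    by_contra hne
    rw [Set.not_nonempty_iff_eq_empty] at hne
    have hk : 0 < k := by
      by_contra hk
      have h0 := hout v
      rw [Nat.eq_zero_of_not_pos hk, Nat.le_zero, Set.ncard_eq_zero] at h0
      exact h0.le ha
    refine hcR (fun _ => ⟨0, hk⟩) (MonoAcyclic.mono (T := {a} ∪ {b}) ?_ ?_) rfl
    · refine (MonoAcyclic.singleton (h.irrefl a)).union (MonoAcyclic.singleton (h.irrefl b)) ?_
      rintro _ rfl _ rfl h' -
      exact (hnd h').elim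
    · intro w hw
      by_contra hcon
      have : w ∈ ({w | w ∉ R ∧ w ≠ a ∧ w ≠ b} : Set V) :=
        ⟨hw, fun e => hcon (.inl e), fun e => hcon (.inr e)⟩
      rw [hne] at this
      exact this
  · intro z hz w hw
    exact (hstep w hw.1 hw.2.1 hw.2.2 z hz).symm

/-- Every colouring of the side `S` of the cut pair `{x, y}` gives `x` and `y` the same colour. -/
def Forced {V : Type*} (r : V → V → Prop) (k : ℕ) (x y : V) (S : Set V) : Prop :=
  ∀ c : V → Fin k, MonoAcyclic r (insert x (insert y S)) c → c x = c y

theorem Forced.comm {x y : V} {S : Set V} (h : Forced r k x y S) : Forced r k y x S :=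
  fun c hc => (h c (by rwa [Set.insert_comm])).symm

theorem Forced.swap {x y : V} {S : Set V} (h : Forced r k x y S) :
    Forced (Function.swap r) k x y S :=
  fun c hc => h c hc.swap

theorem exists_perm_of_ne {α : Type*} {i j i' j' : α} (h : i ≠ j) (h' : i' ≠ j') :
    ∃ σ : Equiv.Perm α, σ i = i' ∧ σ j = j' := by
  classical
  refine ⟨(Equiv.swap i i').trans (Equiv.swap (Equiv.swap i i' j) j'), ?_, by simp⟩
  rw [Equiv.trans_apply, Equiv.swap_apply_left, Equiv.swap_apply_of_ne_of_ne _ h']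
  intro e
  have : Equiv.swap i i' i = Equiv.swap i i' j := by rw [Equiv.swap_apply_left]; exact e
  exact h ((Equiv.swap i i').injective this)

/-- Colourings of the two sides that both distinguish `x` and `y` can be glued, since a
monochromatic cycle then meets `{x, y}` at most once. -/
theorem IsCritical.forced_or_forced (h : IsCritical r k) {x y : V} {S T : Set V}
    (hcut : IsCutPair r x y S T) : Forced r k x y S ∨ Forced r k x y T := by
  classical
  by_contra! hcon
  simp only [Forced, not_forall] at hcon
  obtain ⟨⟨c, hc, hcne⟩, d, hd, hdne⟩ := hcon
  obtain ⟨σ, hσx, hσy⟩ := exists_perm_of_ne hdne hcne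
  let f : V → Fin k := fun v => if v ∈ T then σ (d v) else c v
  have hfS : ∀ v ∈ insert x (insert y S), f v = c v := by
    rintro v (rfl | rfl | hv)
    · exact if_neg hcut.left_notMem_right
    · exact if_neg hcut.right_notMem_right
    · exact if_neg (hcut.disjoint v hv)
  have hfT : ∀ v ∈ insert x (insert y T), f v = (σ ∘ d) v := by
    rintro v (rfl | rfl | hv)
    · exact (if_neg hcut.left_notMem_right).trans hσx.symm
    · exact (if_neg hcut.right_notMem_right).trans hσy.symm
    · exact if_pos hv
  have h1 := hc.congr hfS
  have h2 := (hd.comp σ.injective).congr hfT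
  have hxy : f x ≠ f y := by
    rw [hfS x (by simp), hfS y (by simp)]
    exact hcne
  refine h.not_colourable f (acyclic_of_separated (insert x (insert y S)) (insert x (insert y T))
    ?_ ?_ ?_ ?_)
  · rintro a b ⟨hab, -⟩
    simp only [Set.mem_insert_iff]
    rcases hcut.cover a with ha | ha | ha | ha <;> rcases hcut.cover b with hb | hb | hb | hb <;>
      first
      | (simp only [ha, hb, true_or, or_true, and_self]; done)
      | exact ((hcut.no_arc a ha b hb).1 hab).elim
      | exact ((hcut.no_arc b hb a ha).2 hab).elim
  · have hmem : ∀ a, a ∈ insert x (insert y S) → a ∈ insert x (insert y T) → a = x ∨ a = y := by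
      rintro a (ha | ha | ha) (hb | hb | hb)
      all_goals first | exact .inl ‹_› | exact .inr ‹_› | exact (hcut.disjoint a ha hb).elim
    intro a b haS haT hbS hbT hreach
    have hf : f a = f b := by
      clear hbS hbT
      induction hreach with
      | refl => rfl
      | tail _ hs ih => exact ih.trans hs.2.2.2
    rcases hmem a haS haT with rfl | rfl <;> rcases hmem b hbS hbT with rfl | rfl
    · rfl
    · exact (hxy hf).elim
    · exact (hxy hf.symm).elim
    · rfl
  · exact fun v hv => h1 v (hv.lift id fun _ _ h => ⟨h.1.1, h.2.1, h.2.2, h.1.2.2.2⟩)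
  · exact fun v hv => h2 v (hv.lift id fun _ _ h => ⟨h.1.1, h.2.1, h.2.2, h.1.2.2.2⟩)

theorem IsCutPair.side_ne_univ {x y : V} {S T : Set V} (hcut : IsCutPair r x y S T) :
    insert x (insert y S) ≠ Set.univ := by
  obtain ⟨t, ht⟩ := hcut.nonempty_right
  intro e
  have : t ∈ insert x (insert y S) := e ▸ Set.mem_univ t
  rcases this with rfl | rfl | h
  · exact hcut.left_notMem_right ht
  · exact hcut.right_notMem_right ht
  · exact hcut.disjoint t h ht

theorem IsCutPair.ncard_add_le [Finite V] {x y : V} {S T : Set V} (hcut : IsCutPair r x y S T)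
    (P : V → Prop) : {w | w ∈ S ∧ P w}.ncard + {w | w ∈ T ∧ P w}.ncard ≤ {w | P w}.ncard := by
  rw [← Set.ncard_union_eq]
  · exact Set.ncard_le_ncard (by rintro w (h | h) <;> exact h.2)
  · rw [Set.disjoint_left]
    exact fun w h1 h2 => hcut.disjoint w h1.1 h2.1

theorem ncard_and_or_le (T : Set V) (P Q : V → Prop) :
    {w | w ∈ T ∧ (P w ∨ Q w)}.ncard ≤ {w | w ∈ T ∧ P w}.ncard + {w | w ∈ T ∧ Q w}.ncard := by
  have h : {w | w ∈ T ∧ (P w ∨ Q w)} = {w | w ∈ T ∧ P w} ∪ {w | w ∈ T ∧ Q w} := by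
    ext w
    simp only [Set.mem_ofPred_eq, Set.mem_union]
    tauto
  rw [h]
  exact Set.ncard_union_le _ _

/-- On a side that forces `x` and `y` to share a colour, `x` cannot be recoloured, so it sees all
the other colours there. -/
theorem IsCritical.le_ncard_out_of_forced [Finite V] (h : IsCritical r k) {x y : V} {S T : Set V}
    (hcut : IsCutPair r x y S T) (hF : Forced r k x y S) :
    k ≤ {w | w ∈ S ∧ r x w}.ncard + 1 := by
  classical
  obtain ⟨c, hc⟩ := h.colourable _ hcut.side_ne_univ
  have e := hF c hc
  have key : ∀ j, j ≠ c x → ∃ w ∈ S, r x w ∧ c w = j := by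
    intro j hj
    by_contra! hcon
    have h1 : MonoAcyclic r (insert x (insert y S)) (Function.update c x j) := by
      refine (hc.mono (Set.subset_insert _ _)).insert_of_out ?_ (h.irrefl x) ?_
      · rintro (h | h)
        · exact hcut.ne h
        · exact hcut.left_notMem_left h
      · rintro u (rfl | hu) hxu
        · exact fun h => hj (h ▸ e.symm)
        · exact hcon u hu hxu
    have := hF _ h1
    rw [Function.update_self, Function.update_of_ne hcut.ne.symm, ← e] at this
    exact hj this
  have hsub : (Set.univ : Set (Fin k)) ⊆ insert (c x) (c '' {w | w ∈ S ∧ r x w}) := by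
    intro j _
    by_cases hj : j = c x
    · exact .inl hj
    · obtain ⟨w, hw, hxw, hcw⟩ := key j hj
      exact .inr ⟨w, ⟨hw, hxw⟩, hcw⟩
  have h1 := Set.ncard_le_ncard hsub
  rw [Set.ncard_univ, Nat.card_fin] at h1
  have h2 := Set.ncard_insert_le (c x) (c '' {w | w ∈ S ∧ r x w})
  have h3 := Set.ncard_image_le (f := c) (Set.toFinite {w | w ∈ S ∧ r x w})
  omega

theorem IsCritical.ncard_out_le_one_of_forced [Finite V] (h : IsCritical r k)
    (hout : ∀ v, {w | r v w}.ncard ≤ k) {x y : V} {S T : Set V}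
    (hcut : IsCutPair r x y S T) (hF : Forced r k x y S) :
    {w | w ∈ T ∧ r x w}.ncard ≤ 1 := by
  have h1 := h.le_ncard_out_of_forced hcut hF
  have h2 := hcut.ncard_add_le (r x)
  have h3 := hout x
  omega

/-- If `S` forces `x` and `y` to share a colour, then `x` and `y` together send arcs to at least
`k` vertices on the other side: otherwise some colour is absent from these vertices, and giving it
to `x` and `y` lets no monochromatic cycle enter `T`. -/
theorem IsCritical.le_ncard_out_of_forced_right [Finite V] (h : IsCritical r k) {x y : V}
    {S T : Set V} (hcut : IsCutPair r x y S T) (hF : Forced r k x y S) :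
    k ≤ {w | w ∈ T ∧ (r x w ∨ r y w)}.ncard := by
  classical
  obtain ⟨c, hc⟩ := h.colourable _ hcut.side_ne_univ
  have e := hF c hc
  obtain ⟨d, hd⟩ := h.colourable _ hcut.symm.side_ne_univ
  replace hd : MonoAcyclic r T d :=
    hd.mono ((Set.subset_insert _ _).trans (Set.subset_insert _ _))
  by_contra! hlt
  obtain ⟨j, hj⟩ := exists_colour_notMem _ hlt d
  let f : V → Fin k := fun v => if v ∈ T then Equiv.swap j (c x) (d v) else c v
  have hfS : ∀ v ∈ insert x (insert y S), f v = c v := by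
    rintro v (rfl | rfl | hv)
    · exact if_neg hcut.left_notMem_right
    · exact if_neg hcut.right_notMem_right
    · exact if_neg (hcut.disjoint v hv)
  have hfT : ∀ v ∈ T, f v = (Equiv.swap j (c x) ∘ d) v := fun v hv => if_pos hv
  have hd' : ∀ w ∈ T, (r x w ∨ r y w) → f w ≠ c x := by
    intro w hw hr e'
    rw [hfT w hw, Function.comp_apply, Equiv.swap_apply_eq_iff, Equiv.swap_apply_right] at e'
    exact hj w ⟨hw, hr⟩ e'
  refine h.not_colourable f (MonoAcyclic.mono ((hc.congr hfS).union
    ((hd.comp (Equiv.swap j (c x)).injective).congr hfT) ?_) ?_)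
  · rintro a (rfl | rfl | ha) b hb hab hf
    · rw [hfS a (by simp)] at hf
      exact (hd' b hb (.inl hab) hf.symm).elim
    · rw [hfS a (by simp), ← e] at hf
      exact (hd' b hb (.inr hab) hf.symm).elim
    · exact ((hcut.no_arc a ha b hb).1 hab).elim
  · intro v _
    rcases hcut.cover v with h | h | h | h <;> simp [h]

/-- A `k`-critical digraph with all degrees at most `k ≥ 3` has no cut pair. -/
theorem IsCritical.not_cutPair [Finite V] (h : IsCritical r k) (hk : 3 ≤ k)
    (hout : ∀ v, {w | r v w}.ncard ≤ k) {x y : V} {S T : Set V} :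
    ¬ IsCutPair r x y S T := by
  intro hcut
  wlog hF : Forced r k x y S generalizing S T
  · exact this hcut.symm ((h.forced_or_forced hcut).resolve_left hF)
  have h1 := h.le_ncard_out_of_forced_right hcut hF
  have h2 := h.ncard_out_le_one_of_forced hout hcut hF
  have h3 := h.ncard_out_le_one_of_forced hout hcut.comm hF.comm
  have h4 := ncard_and_or_le T (r x) (r y)
  omega

/-- Suppose `k = 2` and the out-neighbours `x`, `y` of `v` form a cut pair whose side containing
`v` forces `x` and `y` to share a colour. Then `v` is a sink of that side and may be recoloured
freely; this would contradict the forcing if the out-neighbour of `x` there were not `v`. -/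
theorem IsCritical.arc_of_forced [Finite V] (h : IsCritical r 2)
    (hout : ∀ v, {w | r v w}.ncard ≤ 2) (hin : ∀ v, {w | r w v}.ncard ≤ 2) {v x y : V}
    {S T : Set V} (hcut : IsCutPair r x y S T) (hF : Forced r 2 x y S) (hv : v ∈ S)
    (hvy : r v y) (hN : ∀ w, r v w → w = x ∨ w = y) : r x v := by
  classical
  have ncard_out_le_one : ∀ {r : V → V → Prop} {x y : V}, IsCritical r 2 →
      (∀ v, {w | r v w}.ncard ≤ 2) → IsCutPair r x y S T → Forced r 2 x y S →
      {w | w ∈ S ∧ r x w}.ncard ≤ 1 := by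
    intro r x y h hout hcut hF
    have h1 := h.le_ncard_out_of_forced_right hcut hF
    have h3 := h.ncard_out_le_one_of_forced hout hcut.comm hF.comm
    have h4 := ncard_and_or_le T (r x) (r y)
    have h6 := hcut.ncard_add_le (r x)
    have h7 := hout x
    omega
  have hxS := ncard_out_le_one h hout hcut hF
  have hyS := ncard_out_le_one h.swap hin hcut.comm.swap hF.comm.swap
  rw [Set.ncard_le_one_iff] at hxS hyS
  by_contra hxv
  obtain ⟨s, hsS, hxs⟩ : ∃ s, s ∈ S ∧ r x s := by
    have h1 := h.le_ncard_out_of_forced hcut hF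
    exact Set.nonempty_of_ncard_ne_zero (s := {w | w ∈ S ∧ r x w}) (by omega)
  have hsv : s ≠ v := fun e => hxv (e ▸ hxs)
  obtain ⟨c, hc⟩ := h.colourable _ hcut.side_ne_univ
  obtain ⟨i, hi⟩ : ∃ i, i ≠ c s := exists_ne (c s)
  have h1 : MonoAcyclic r (insert v (S \ {v})) (Function.update c v i) := by
    refine (hc.mono ?_).insert_of_out (by simp) (h.irrefl v) ?_
    · exact fun u hu => .inr (.inr hu.1)
    · intro u hu hvu
      rcases hN u hvu with rfl | rfl
      · exact (hcut.left_notMem_left hu.1).elim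
      · exact (hcut.right_notMem_left hu.1).elim
  rw [Set.insert_sdiff_singleton, Set.insert_eq_of_mem hv] at h1
  have h2 := h1.insert_of_in (v := y) (j := c s) hcut.right_notMem_left (h.irrefl y) (by
    intro u hu huy
    obtain rfl : u = v := hyS ⟨hu, huy⟩ ⟨hv, hvy⟩
    rwa [Function.update_self])
  have h3 := h2.insert_of_out (v := x) (j := i) (fun h => h.elim hcut.ne hcut.left_notMem_left)
    (h.irrefl x) (by
      rintro u (rfl | hu) hxu
      · rw [Function.update_self]
        exact hi.symm
      · obtain rfl : u = s := hxS ⟨hu, hxu⟩ ⟨hsS, hxs⟩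
        rw [Function.update_of_ne (ne_of_mem_of_not_mem hu hcut.right_notMem_left),
          Function.update_of_ne hsv]
        exact hi.symm)
  have := hF _ h3
  rw [Function.update_self, Function.update_of_ne hcut.ne.symm, Function.update_self] at this
  exact hi this

/-- In a `2`-critical digraph with all degrees at most `2`, the out-neighbours of a vertex with
different out- and in-neighbourhoods form a digon. -/
theorem IsCritical.arc_of_two [Finite V] (h : IsCritical r 2)
    (hout : ∀ v, {w | r v w}.ncard ≤ 2) (hin : ∀ v, {w | r w v}.ncard ≤ 2) {v a b : V}
    (hv : ¬ ∀ w, r v w ↔ r w v) (ha : r v a) (hb : r v b) (hab : a ≠ b) : r a b := by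
  classical
  by_contra hnd
  obtain ⟨S, T, hvS, hcut⟩ := h.exists_cutPair hout hin ha hb hab hnd
  have pair : ∀ {r : V → V → Prop}, (∀ v, {w | r v w}.ncard ≤ 2) → r v a → r v b →
      ∀ w, r v w → w = a ∨ w = b := by
    intro r hout ha hb w hw
    have hsub : {a, b} ⊆ {w | r v w} := by
      rintro _ (rfl | rfl)
      exacts [ha, hb]
    have e := Set.eq_of_subset_of_ncard_le hsub (by rw [Set.ncard_pair hab]; exact hout v)
    have : w ∈ ({a, b} : Set V) := e ▸ hw
    simpa using this
  have hN := pair hout ha hb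
  rcases h.forced_or_forced hcut with hF | hF
  · have h1 := h.arc_of_forced hout hin hcut hF hvS hb hN
    have h2 := h.arc_of_forced hout hin hcut.comm hF.comm hvS ha fun w hw => (hN w hw).symm
    have hN' := pair (r := Function.swap r) hin h1 h2
    refine hv fun w => ⟨fun hw => ?_, fun hw => ?_⟩
    · rcases hN w hw with rfl | rfl
      exacts [h1, h2]
    · rcases hN' w hw with rfl | rfl
      exacts [ha, hb]
  · -- Now `v` is the only in-neighbour of both `a` and `b` on its side.
    have h1 := h.swap.le_ncard_out_of_forced_right hcut.symm.swap hF.swap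
    have h2 := h.swap.ncard_out_le_one_of_forced hin hcut.symm.swap hF.swap
    have h3 := h.swap.ncard_out_le_one_of_forced hin hcut.symm.comm.swap hF.comm.swap
    rw [Set.ncard_le_one_iff] at h2 h3
    have h4 : {w | w ∈ S ∧ (r w a ∨ r w b)} ⊆ {v} := by
      rintro w ⟨hw, hwa | hwb⟩
      · exact h2 ⟨hw, hwa⟩ ⟨hvS, ha⟩
      · exact h3 ⟨hw, hwb⟩ ⟨hvS, hb⟩
    have h5 := Set.ncard_le_ncard h4
    rw [Set.ncard_singleton] at h5
    have h6 : 2 ≤ {w | w ∈ S ∧ (r w a ∨ r w b)}.ncard := h1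
    omega

/-! ### Cliques in critical digraphs of degree at least three -/

/-- Directed Brooks' theorem for `k ≥ 3`: a `k`-critical digraph with all degrees at most `k`
contains the bidirected complete graph on `k + 1` vertices. -/
theorem IsCritical.exists_clique [Finite V] (h : IsCritical r k) (hk : 3 ≤ k)
    (hout : ∀ v, {w | r v w}.ncard ≤ k) (hin : ∀ v, {w | r w v}.ncard ≤ k) :
    ∃ Q : Set V, Q.ncard = k + 1 ∧ ∀ a ∈ Q, ∀ b ∈ Q, a ≠ b → r a b := by
  classical
  have hcl : ∀ v a b, r v a → r v b → a ≠ b → r a b := by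
    intro v a b ha hb hab
    by_contra hnd
    obtain ⟨S, T, -, hcut⟩ := h.exists_cutPair hout hin ha hb hab hnd
    exact h.not_cutPair hk hout hcut
  have hdeg : ∀ v, {w | r v w}.ncard = k := fun v => (hout v).antisymm (h.le_out v)
  obtain ⟨v⟩ : Nonempty V := by
    by_contra hV
    rw [not_nonempty_iff] at hV
    exact h.not_colourable isEmptyElim isEmptyElim
  obtain ⟨w, hw, w', hw', hne⟩ : ∃ w, r v w ∧ ∃ w', r v w' ∧ w ≠ w' := by
    have : 1 < {w | r v w}.ncard := by rw [hdeg]; omega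
    obtain ⟨w, hw, w', hw', hne⟩ := (Set.one_lt_ncard_iff_nontrivial).1 this
    exact ⟨w, hw, w', hw', hne⟩
  -- `w` has an out-neighbour `x` besides the other out-neighbours of `v`.
  obtain ⟨x, hwx, hx⟩ : ∃ x, r w x ∧ ¬ r v x := by
    by_contra! hcon
    have h1 : {u | r w u} ⊆ {u | r v u} \ {w} := by
      intro u hu
      refine ⟨hcon u hu, ?_⟩
      rintro rfl
      exact h.irrefl _ hu
    have h2 := Set.ncard_le_ncard h1
    have h3 := Set.ncard_sdiff_singleton_lt_of_mem (s := {u | r v u}) hw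
    rw [hdeg] at h2 h3
    omega
  have hxN : ∀ u, r v u → r u x ∧ r x u := by
    have hother : ∀ u, r v u → u ≠ w → r u x ∧ r x u := by
      intro u hu huw
      have h1 := hcl v w u hw hu huw.symm
      have hux : u ≠ x := fun e => hx (e ▸ hu)
      exact ⟨hcl w u x h1 hwx hux, hcl w x u hwx h1 hux.symm⟩
    intro u hu
    by_cases huw : u = w
    · subst huw
      exact ⟨hwx, hcl w' x u (hother w' hw' hne.symm).1 (hcl v w' u hw' hw hne.symm)
        fun e => hx (e ▸ hw)⟩
    · exact hother u hu huw
  refine ⟨insert x {u | r v u}, ?_, ?_⟩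
  · rw [Set.ncard_insert_of_notMem (show x ∉ {u | r v u} from hx), hdeg]
  · rintro a (rfl | ha) b (rfl | hb) hab
    · exact (hab rfl).elim
    · exact (hxN b hb).2
    · exact (hxN a ha).1
    · exact hcl v a b ha hb hab

end Critical

/-! ### Counting arcs and passing to a critical subdigraph -/

/-- If all arcs between `X` and its complement lie in digons, the out-degrees and the in-degrees
of the vertices of `X` have the same sum; so if the former are at most `k` and the latter at least
`k`, then the latter are equal to `k`. -/
theorem ncard_in_le_of_symm {V : Type*} [Fintype V] {r : V → V → Prop} {k : ℕ} (X : Set V)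
    (hsymm : ∀ a ∈ X, ∀ b ∉ X, r a b ↔ r b a)
    (hout : ∀ v ∈ X, {w | r v w}.ncard ≤ k) (hin : ∀ v ∈ X, k ≤ {w | r w v}.ncard) :
    ∀ v ∈ X, {w | r w v}.ncard ≤ k := by
  classical
  have hcard : ∀ P : V → Prop, {w | P w}.ncard = ∑ w, if P w then 1 else 0 := by
    intro P
    rw [Finset.sum_boole, Set.ncard_eq_toFinset_card']
    simp
  have hsum : ∑ v ∈ Finset.univ.filter (· ∈ X), {w | r v w}.ncard
      = ∑ v ∈ Finset.univ.filter (· ∈ X), {w | r w v}.ncard := by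
    simp_rw [hcard]
    have split : ∀ f : V → ℕ, ∑ w, f w = ∑ w ∈ Finset.univ.filter (· ∈ X), f w
        + ∑ w ∈ Finset.univ.filter (· ∉ X), f w := fun f =>
      (Finset.sum_filter_add_sum_filter_not _ _ _).symm
    simp_rw [split, Finset.sum_add_distrib]
    congr 1
    · exact Finset.sum_comm
    · refine Finset.sum_congr rfl fun v hv => Finset.sum_congr rfl fun w hw => ?_
      rw [Finset.mem_filter] at hv hw
      simp only [hsymm v hv.2 w hw.2]
  intro v hv
  by_contra! hlt
  have h1 : ∑ v ∈ Finset.univ.filter (· ∈ X), {w | r v w}.ncard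
      < ∑ v ∈ Finset.univ.filter (· ∈ X), {w | r w v}.ncard := by
    refine Finset.sum_lt_sum (fun u hu => ?_) ⟨v, by simpa using hv, ?_⟩
    · have hu := (Finset.mem_filter.1 hu).2
      exact (hout u hu).trans (hin u hu)
    · exact (hout v hv).trans_lt hlt
  exact h1.ne hsum

/-- A loopless digraph that is not `k`-dicolourable has a critical induced subdigraph. -/
theorem exists_isCritical {V : Type*} [Finite V] {r : V → V → Prop} {k : ℕ}
    (hr : ∀ v, ¬ r v v) (hcol : ∀ c : V → Fin k, ¬ MonoAcyclic r Set.univ c) (hk : 0 < k) :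
    ∃ U : Set V, IsCritical (fun a b : U => r a b) k := by
  classical
  obtain ⟨U, hU, hmin⟩ := Set.Finite.exists_minimal
    (Set.toFinite {U : Set V | ∀ c : V → Fin k, ¬ MonoAcyclic r U c}) ⟨_, hcol⟩
  refine ⟨U, fun v => hr v, fun c hc => ?_, fun S hS => ?_⟩
  · refine hU (fun v => if hv : v ∈ U then c ⟨v, hv⟩ else ⟨0, hk⟩) fun v hv => ?_
    have key : ∀ w, TransGen (fun a b => r a b ∧ a ∈ U ∧ b ∈ U ∧
        (if hv : a ∈ U then c ⟨a, hv⟩ else ⟨0, hk⟩) = if hv : b ∈ U then c ⟨b, hv⟩ else ⟨0, hk⟩)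
        v w → ∃ (hv : v ∈ U) (hw : w ∈ U), TransGen (fun a b : U => r a b ∧ a ∈ Set.univ ∧
          b ∈ Set.univ ∧ c a = c b) ⟨v, hv⟩ ⟨w, hw⟩ := by
      intro w hw
      induction hw with
      | single h =>
        obtain ⟨h, ha, hb, e⟩ := h
        rw [dif_pos ha, dif_pos hb] at e
        exact ⟨ha, hb, .single ⟨h, trivial, trivial, e⟩⟩
      | tail _ h ih =>
        obtain ⟨h, ha, hb, e⟩ := h
        obtain ⟨hv, hw, ih⟩ := ih
        rw [dif_pos ha, dif_pos hb] at e
        exact ⟨hv, hb, ih.tail ⟨h, trivial, trivial, e⟩⟩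
    obtain ⟨hv, _, h⟩ := key v hv
    exact hc _ h
  · have : ¬ ∀ c : V → Fin k, ¬ MonoAcyclic r (Subtype.val '' S) c := by
      intro hcon
      refine hS (Set.eq_univ_of_forall fun u => ?_)
      have := hmin hcon (by rintro _ ⟨u, -, rfl⟩; exact u.2) u.2
      simpa using this
    push Not at this
    obtain ⟨c, hc⟩ := this
    refine ⟨c ∘ Subtype.val, fun v hv => hc v.1 (hv.lift Subtype.val ?_)⟩
    exact fun a b h => ⟨h.1, ⟨a, h.2.1, rfl⟩, ⟨b, h.2.2.1, rfl⟩, h.2.2.2⟩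

/-! ### Symmetrizing the arcs between two parts -/

/-- The digraph obtained from `D` by replacing every arc from `X` to its complement by a digon and
deleting the other arcs from the complement of `X` to `X`. -/
def symmetrize {V : Type*} (D : Digraph V) (X : Set V) (a b : V) : Prop :=
  (a ∉ X ∧ b ∈ X ∧ D.Adj b a) ∨ (¬ (a ∉ X ∧ b ∈ X) ∧ D.Adj a b)

section symmetrize

variable {V : Type*} {D : Digraph V} {X : Set V}

theorem symmetrize_of_mem_left {a b : V} (ha : a ∈ X) : symmetrize D X a b ↔ D.Adj a b := by
  simp [symmetrize, ha]

theorem symmetrize_of_notMem_right {a b : V} (hb : b ∉ X) : symmetrize D X a b ↔ D.Adj a b := by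
  simp [symmetrize, hb]

theorem symmetrize_comm {a b : V} (ha : a ∈ X) (hb : b ∉ X) :
    symmetrize D X a b ↔ symmetrize D X b a := by
  simp [symmetrize, ha, hb]

/-- A monochromatic cycle of `D` either lies inside `X` or its complement, or uses an arc from
`X` to its complement, hence a digon of `symmetrize D X`. -/
theorem dicolourable_of_symmetrize {k : ℕ} (c : V → Fin k)
    (hc : MonoAcyclic (symmetrize D X) Set.univ c) : D.Dicolourable k := by
  have hacyc : ∀ v, ¬ TransGen (fun a b => D.Adj a b ∧ c a = c b) v v := by
    refine acyclic_of_closed X ?_ ?_ ?_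
    · rintro a b ⟨hab, e⟩ ha
      by_contra hb
      have h1 : symmetrize D X a b := (symmetrize_of_mem_left ha).2 hab
      have h2 := (symmetrize_comm ha hb).1 h1
      exact hc a (.tail (.single ⟨h1, trivial, trivial, e⟩) ⟨h2, trivial, trivial, e.symm⟩)
    · exact fun v hv => hc v (hv.lift id fun a b h =>
        ⟨(symmetrize_of_mem_left h.2.1).2 h.1.1, trivial, trivial, h.1.2⟩)
    · exact fun v hv => hc v (hv.lift id fun a b h =>
        ⟨(symmetrize_of_notMem_right h.2.2).2 h.1.1, trivial, trivial, h.1.2⟩)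
  refine ⟨c, fun i v hv => hacyc v.1 (hv.lift Subtype.val ?_)⟩
  exact fun a b h => ⟨h, a.2.trans b.2.symm⟩

end symmetrize

/-! ### Copies of the extremal digraphs -/

/-- Disjoint bidirected cliques `A` and `B` with all arcs from `A` to `B` form a copy of the
directed join of two bidirected complete graphs. -/
theorem contains_directedJoin {V : Type*} (D : Digraph V) (A B : Finset V)
    (hA : ∀ a ∈ A, ∀ b ∈ A, a ≠ b → D.Adj a b) (hB : ∀ a ∈ B, ∀ b ∈ B, a ≠ b → D.Adj a b)
    (hdisj : Disjoint A B) (hAB : ∀ a ∈ A, ∀ b ∈ B, D.Adj a b) :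
    D.Contains (Digraph.directedJoin (Digraph.bidirectedComplete A.card)
      (Digraph.bidirectedComplete B.card)) := by
  let f : Fin A.card → V := fun i => (A.equivFin.symm i : V)
  let g : Fin B.card → V := fun i => (B.equivFin.symm i : V)
  have hf : Function.Injective f := Subtype.val_injective.comp A.equivFin.symm.injective
  have hg : Function.Injective g := Subtype.val_injective.comp B.equivFin.symm.injective
  have hfA : ∀ i, f i ∈ A := fun i => (A.equivFin.symm i).2
  have hgB : ∀ i, g i ∈ B := fun i => (B.equivFin.symm i).2
  refine ⟨⟨Sum.elim f g, hf.sumElim hg fun i j e => ?_⟩, ?_⟩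
  · exact Finset.disjoint_left.1 hdisj (hfA i) (e ▸ hgB j)
  · rintro (a | a) (b | b) h
    · exact hA _ (hfA a) _ (hfA b) (hf.ne h)
    · exact hAB _ (hfA a) _ (hgB b)
    · exact h.elim
    · exact hB _ (hgB a) _ (hgB b) (hg.ne h)

theorem contains_digon {V : Type*} (D : Digraph V) {a b : V} (hne : a ≠ b) (hab : D.Adj a b)
    (hba : D.Adj b a) : D.Contains (Digraph.bidirectedComplete 2) := by
  refine ⟨⟨![a, b], ?_⟩, ?_⟩
  · intro i j
    fin_cases i <;> fin_cases j <;> simp [hne, hne.symm]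
  · intro i j h
    have hij : i ≠ j := h
    fin_cases i <;> fin_cases j
    exacts [(hij rfl).elim, hab, hba, (hij rfl).elim]

/-! ### Digons in critical digraphs of degree two -/

/-- In a `2`-critical digraph with all degrees at most `2`, if all arcs between `X` and its
complement lie in digons, then some digon lies inside `X` or inside its complement. -/
theorem IsCritical.exists_digon_same_side {V : Type*} [Finite V] {r : V → V → Prop}
    (h : IsCritical r 2) (hout : ∀ v, {w | r v w}.ncard ≤ 2) (hin : ∀ v, {w | r w v}.ncard ≤ 2)
    (X : Set V) (hsymm : ∀ a ∈ X, ∀ b ∉ X, r a b ↔ r b a) :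
    ∃ a b, (a ∈ X ↔ b ∈ X) ∧ r a b ∧ r b a := by
  classical
  by_contra! hcon
  have hcross : ∀ a b, ¬ (a ∈ X ↔ b ∈ X) → r a b → r b a := by
    intro a b hab hr
    by_cases ha : a ∈ X
    · exact (hsymm a ha b (by tauto)).1 hr
    · exact (hsymm b (by tauto) a ha).2 hr
  obtain ⟨v, hv⟩ : ∃ v, ¬ ∀ w, r v w ↔ r w v := by
    by_contra! hall
    -- If all arcs lie in digons, the bipartition `X`, `Xᶜ` is a proper colouring.
    refine h.not_colourable (fun v => if v ∈ X then 0 else 1) fun v hv => ?_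
    obtain ⟨w, ⟨hvw, -, -, e⟩, -⟩ := TransGen.head'_iff.1 hv
    refine hcon v w ?_ hvw ((hall v w).1 hvw)
    by_cases h1 : v ∈ X <;> by_cases h2 : w ∈ X <;> simp_all
  -- The two out-neighbours of `v` form a digon, so one of them is on the same side as `v`, the
  -- other one on the other side.
  have nbrs : ∀ {r : V → V → Prop}, IsCritical r 2 → (∀ v, {w | r v w}.ncard ≤ 2) →
      (∀ v, {w | r w v}.ncard ≤ 2) → (¬ ∀ w, r v w ↔ r w v) →
      (∀ a b, (a ∈ X ↔ b ∈ X) → r a b → ¬ r b a) →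
      ∃ a b, r v a ∧ r v b ∧ r a b ∧ r b a ∧ (a ∈ X ↔ v ∈ X) ∧ ¬ (b ∈ X ↔ v ∈ X) := by
    intro r h hout hin hv hcon
    obtain ⟨a, ha, b, hb, hab⟩ := (Set.one_lt_ncard_iff_nontrivial).1 (h.le_out v)
    have h1 := h.arc_of_two hout hin hv ha hb hab
    have h2 := h.arc_of_two hout hin hv hb ha hab.symm
    have h3 := fun e => hcon a b e h1 h2
    by_cases hav : a ∈ X ↔ v ∈ X
    · exact ⟨a, b, ha, hb, h1, h2, hav, by tauto⟩
    · exact ⟨b, a, hb, ha, h2, h1, by tauto, hav⟩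
  obtain ⟨a, b, hva, hvb, hab, hba, haX, hbX⟩ := nbrs h hout hin hv hcon
  obtain ⟨a', b', hva', hvb', hab', hba', haX', hbX'⟩ := nbrs h.swap hin hout
    (fun h => hv fun w => (h w).symm) (fun a b e h1 h2 => hcon a b e h2 h1)
  simp only [Function.swap] at hva' hvb' hab' hba'
  have hbv := hcross v b (by tauto) hvb
  have hvb'' := hcross b' v (by tauto) hvb'
  have hle : ∀ w x y z : V, r w x → r w y → r w z → x ≠ y → x ≠ z → y = z := by
    intro w x y z hx hy hz hxy hxz
    by_contra hyz
    have hsub : {x, y, z} ⊆ {u | r w u} := by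
      rintro _ (rfl | rfl | rfl)
      exacts [hx, hy, hz]
    have h1 := Set.ncard_le_ncard hsub
    have h2 := hout w
    rw [Set.ncard_eq_three.2 ⟨x, y, z, hxy, hxz, hyz, rfl⟩] at h1
    omega
  have hne : ∀ x y, r x y → x ≠ y := by
    rintro x _ hxy rfl
    exact h.irrefl x hxy
  have e1 : b = b' := hle v a b b' hva hvb hvb'' (hne _ _ hab) (by rintro rfl; tauto)
  subst e1
  have e2 : a = a' := hle b v a a' hbv hba hab' (hne _ _ hva) (hne _ _ hva').symm
  subst e2
  exact hcon v a (by tauto) hva hva'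

end DirectedBrooks

open DirectedBrooks in
theorem theorem6 {V : Type*} [Fintype V] (D : Digraph V) (hloop : ∀ v : V, ¬ D.Adj v v)
    (hD : ¬ D.Dicolourable D.deltaMin) :
    D.deltaMin ≤ 1 ∨
    (D.deltaMin = 2 ∧ D.Contains (Digraph.bidirectedComplete 2)) ∨
    (3 ≤ D.deltaMin ∧ ∃ r s : ℕ, r + s = D.deltaMin + 1 ∧
      D.Contains (Digraph.directedJoin (Digraph.bidirectedComplete r)
        (Digraph.bidirectedComplete s))) := by
  classical
  have hdeg : ∀ v, min (D.outDegree v) (D.inDegree v) ≤ D.deltaMin := fun v =>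
    Finset.le_sup (f := D.dMin) (Finset.mem_univ v)
  generalize D.deltaMin = k at *
  by_cases hk1 : k ≤ 1
  · exact .inl hk1
  refine .inr ?_
  let X : Set V := {v | D.outDegree v ≤ k}
  -- Every vertex outside `X` has in-degree at most `k`.
  have hY : ∀ v, v ∉ X → D.inDegree v ≤ k := fun v hv =>
    (min_le_iff.1 (hdeg v)).resolve_left hv
  have hirr : ∀ v, ¬ symmetrize D X v v := by
    intro v hv
    rcases hv with hv | hv
    · exact hv.1 hv.2.1
    · exact hloop v hv.2
  obtain ⟨U, hU⟩ := exists_isCritical hirr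
    (fun c hc => hD (dicolourable_of_symmetrize c hc)) (by omega)
  set r : U → U → Prop := fun a b => symmetrize D X a b with hr
  let X' : Set U := {u | u.1 ∈ X}
  have hsymm : ∀ a ∈ X', ∀ b ∉ X', r a b ↔ r b a := fun a ha b hb => symmetrize_comm ha hb
  have hsub : ∀ (P : U → Prop) (Q : V → Prop), (∀ u, P u → Q u) →
      {u | P u}.ncard ≤ {v | Q v}.ncard := by
    intro P Q hPQ
    rw [← Set.ncard_image_of_injective _ Subtype.val_injective]
    refine Set.ncard_le_ncard ?_
    rintro _ ⟨u, hu, rfl⟩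
    exact hPQ u hu
  have houtX : ∀ v ∈ X', {w | r v w}.ncard ≤ k := fun v hv =>
    (hsub (r v) (D.Adj v) fun w hw =>
      (symmetrize_of_mem_left (show v.1 ∈ X from hv)).1 hw).trans hv
  have hinY : ∀ v ∈ X'ᶜ, {w | r w v}.ncard ≤ k := fun v hv =>
    (hsub (fun w => r w v) (fun w => D.Adj w v) fun w hw =>
      (symmetrize_of_notMem_right (show v.1 ∉ X from hv)).1 hw).trans
      (hY v hv)
  -- Criticality bounds all degrees from below, so counting arcs bounds the
  -- remaining ones from above.
  have hinX := ncard_in_le_of_symm X' hsymm houtX fun v _ => hU.swap.le_out v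
  have houtY := ncard_in_le_of_symm (r := Function.swap r) X'ᶜ
    (fun a ha b hb => hsymm b (not_not.1 hb) a ha) hinY fun v _ => hU.le_out v
  have hout : ∀ v, {w | r v w}.ncard ≤ k := fun v =>
    (em (v ∈ X')).elim (houtX v) (houtY v)
  have hin : ∀ v, {w | r w v}.ncard ≤ k := fun v =>
    (em (v ∈ X')).elim (hinX v) (hinY v)
  by_cases hk2 : k = 2
  · subst hk2
    refine .inl ⟨rfl, ?_⟩
    obtain ⟨a, b, hab, h1, h2⟩ := hU.exists_digon_same_side hout hin X' hsymm
    have hne : a.1 ≠ b.1 := fun e => hU.irrefl a (by rw [← Subtype.ext e] at h1; exact h1)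
    by_cases ha : a ∈ X'
    · exact contains_digon D hne ((symmetrize_of_mem_left (show a.1 ∈ X from ha)).1 h1)
        ((symmetrize_of_mem_left (show b.1 ∈ X from hab.1 ha)).1 h2)
    · exact contains_digon D hne ((symmetrize_of_notMem_right
          (show b.1 ∉ X from fun h => ha (hab.2 h))).1 h1)
        ((symmetrize_of_notMem_right (show a.1 ∉ X from ha)).1 h2)
  · have hk3 : 3 ≤ k := by omega
    refine .inr ⟨hk3, ?_⟩
    obtain ⟨Q, hQcard, hQ⟩ := hU.exists_clique hk3 hout hin
    let Q' : Finset V := Finset.univ.filter (· ∈ Subtype.val '' Q)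
    have hQ'card : Q'.card = k + 1 := by
      rw [← hQcard, ← Set.ncard_image_of_injective Q Subtype.val_injective,
        Set.ncard_eq_toFinset_card']
      congr 1
      ext
      simp [Q']
    have hQ' : ∀ a ∈ Q', ∀ b ∈ Q', a ≠ b → symmetrize D X a b := by
      intro a ha b hb hab
      obtain ⟨a, haQ, rfl⟩ := (Finset.mem_filter.1 ha).2
      obtain ⟨b, hbQ, rfl⟩ := (Finset.mem_filter.1 hb).2
      exact hQ a haQ b hbQ fun e => hab (congrArg _ e)
    refine ⟨(Q'.filter (· ∈ X)).card, (Q'.filter (· ∉ X)).card, ?_,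
      contains_directedJoin D _ _ ?_ ?_ ?_ ?_⟩
    · rw [Finset.card_filter_add_card_filter_not, hQ'card]
    · intro a ha b hb hab
      rw [Finset.mem_filter] at ha hb
      exact (symmetrize_of_mem_left ha.2).1 (hQ' a ha.1 b hb.1 hab)
    · intro a ha b hb hab
      rw [Finset.mem_filter] at ha hb
      exact (symmetrize_of_notMem_right hb.2).1 (hQ' a ha.1 b hb.1 hab)
    · exact Finset.disjoint_filter_filter_not _ _ _
    · intro a ha b hb
      rw [Finset.mem_filter] at ha hb
      exact (symmetrize_of_mem_left ha.2).1
        (hQ' a ha.1 b hb.1 fun e => hb.2 (e ▸ ha.2))
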